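/- Identify $\mathbb{R}^2\times I$, $I=[0,1]$, with $\{(x,y,z)\in\mathbb{R}^3 : 0\le z\le 1\}$. For $X=\mathbb{R}^3$ (with $n=3$) or $X=\mathbb{R}^2\times I$ (with $n=2$), a translational action of $\mathbb{Z}^n$ on $X$ is a homomorphism $\mathbb{Z}^n\to\mathrm{Isom}(X)$ whose $n$ standard generators act as translations by linearly independent vectors. A triply (respectively doubly) periodic tangle is a smooth, properly embedded (that is, closed as a subset of $X$) 1-dimensional submanifold without boundary of the interior of $X=\mathbb{R}^3$ (respectively $X=\mathbb{R}^2\times I$) that is mapped to itself by a translational action of $\mathbb{Z}^3$ (respectively $\mathbb{Z}^2$). **Proposition.** Let $\tau\subset\mathbb{R}^3$ be a triply periodic tangle preserved by a translational action $\sigma\colon\mathbb{Z}^3\to\mathrm{Isom}(\mathbb{R}^3)$, and let $C_1$ and $C_2$ be connected components of $\tau$ (possibly equal). Then there are - a doubly periodic tangle $\tau_0\subset\mathbb{R}^2\times I$ preserved by a translational action $\rho\colon\mathbb{Z}^2\to\mathrm{Isom}(\mathbb{R}^2\times I)$, - an orientation-preserving smooth embedding $\iota\colon\mathbb{R}^2\times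 I\to\mathbb{R}^3$, and - connected components $C_{1,0}$ and $C_{2,0}$ of $\tau_0$ such that - $\rho$ is a restriction of $\sigma$, that is, there is an injective homomorphism $j\colon\mathbb{Z}^2\to\mathbb{Z}^3$ with $\iota(\rho(g)x)=\sigma(j(g))\,\iota(x)$ for all $g\in\mathbb{Z}^2$ and $x\in\mathbb{R}^2\times I$, - $\iota(\tau_0)\subset\tau$, and - $\iota(C_{i,0})=C_i$ for $i=1,2$. -/

import Mathlib

open scoped ContDiff

/-- Euclidean 3-space `ℝ³`. -/
abbrev Space3 : Type := EuclideanSpace ℝ (Fin 3)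

/-- The thickened plane `ℝ² × I`, with `I = [0, 1]`, as the closed region
`{(x, y, z) | 0 ≤ z ≤ 1}` of `ℝ³` (with the induced Euclidean metric and orientation). -/
def thickenedPlane : Set Space3 := {x | x 2 ∈ Set.Icc (0 : ℝ) 1}

/-- `s` is a smooth embedded 1-dimensional submanifold (without boundary) of `ℝ³`: around each of
its points there is a smooth chart of `ℝ³` that straightens `s` to the first coordinate axis. -/
def IsSmoothCurve (s : Set Space3) : Prop :=
  ∀ p ∈ s, ∃ Φ : OpenPartialHomeomorph Space3 Space3,
    p ∈ Φ.source ∧ ContDiffOn ℝ ∞ Φ Φ.source ∧ ContDiffOn ℝ ∞ Φ.symm Φ.target ∧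
      Φ '' (s ∩ Φ.source) = Φ.target ∩ {y | y 1 = 0 ∧ y 2 = 0}

/-- An isometric action `ρ` of `ℤⁿ` on a region `X ⊆ ℝ³` is translational if its `n` generators act
as translations by `n` linearly independent vectors. -/
def IsTranslational {n : ℕ} {X : Set Space3}
    (ρ : Multiplicative (Fin n → ℤ) →* (X ≃ᵢ X)) : Prop :=
  ∃ v : Fin n → Space3, LinearIndependent ℝ v ∧
    ∀ (m : Fin n → ℤ) (x : X),
      (ρ (Multiplicative.ofAdd m) x : Space3) = (x : Space3) + ∑ i, m i • v i

/-- `τ` is a periodic tangle in the region `X ⊆ ℝ³`, preserved by the translational action `ρ` of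
`ℤⁿ`: a properly embedded 1-dimensional submanifold of `ℝ³` in the interior of `X` which is mapped
to itself by `ρ`. (Properness, i.e. closedness in `X`, says that the quotient of `τ` is
a link, which is compact, in the quotient of `X`.) -/
structure IsPeriodicTangle {n : ℕ} {X : Set Space3}
    (ρ : Multiplicative (Fin n → ℤ) →* (X ≃ᵢ X)) (τ : Set Space3) : Prop where
  translational : IsTranslational ρ
  curve : IsSmoothCurve τ
  subset_interior : τ ⊆ interior X
  closed : IsClosed ((↑) ⁻¹' τ : Set X)
  preserved : ∀ g, ρ g '' ((↑) ⁻¹' τ : Set X) = (↑) ⁻¹' τ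

/-- A doubly periodic tangle in `ℝ² × I`, preserved by the translational action `ρ` of `ℤ²`. -/
def IsDoublyPeriodicTangle
    (ρ : Multiplicative (Fin 2 → ℤ) →* (thickenedPlane ≃ᵢ thickenedPlane))
    (τ : Set Space3) : Prop :=
  IsPeriodicTangle ρ τ

/-- A triply periodic tangle in `ℝ³`, preserved by the translational action `σ` of `ℤ³`. -/
def IsTriplyPeriodicTangle
    (σ : Multiplicative (Fin 3 → ℤ) →* ((Set.univ : Set Space3) ≃ᵢ (Set.univ : Set Space3)))
    (τ : Set Space3) : Prop :=
  IsPeriodicTangle σ τ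

/-- `C` is a (connected) component of `τ`. -/
def IsTangleComponent (C τ : Set Space3) : Prop :=
  ∃ x ∈ τ, C = connectedComponentIn τ x

/-- `ι : ℝ² × I → ℝ³` is an orientation-preserving smooth embedding: it is smooth (up to the
boundary), a homeomorphism onto its image, and its Jacobian determinant is positive everywhere. -/
structure IsOrientedEmbedding (ι : thickenedPlane → Space3) : Prop where
  isEmbedding : Topology.IsEmbedding ι
  smooth : ∃ f : Space3 → Space3, (∀ x : thickenedPlane, f x = ι x) ∧
    ContDiffOn ℝ ∞ f thickenedPlane ∧
    ∀ x ∈ thickenedPlane, 0 < (fderivWithin ℝ f thickenedPlane x).det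

open Set Filter Topology

/-! Translational symmetry forces every component of `τ` to stay within bounded distance of a line
or a point. Cocompactness gives a uniform length of arc around all points of `τ`, so unit speed arcs
extend to complete curves `γ : ℝ → τ` (`IsCocompactCurve.exists_complete`), whose ranges are exactly
the components (`component_subset_range`, `range_subset_component`).

Lattice translates of the points `γ n` accumulate, so two of them lie on one short arc of `τ`. By
rigidity of unit speed curves (`UnitSpeedOn.eq_of_eq`), a lattice translate of `γ` is then a shift
or a reflection of `γ`; a reflection would reverse the velocity at its fixed parameter. Hence `γ (u
+ T) = γ u + w` with `T ≠ 0` and `w` in the lattice (`exists_period`), where `w = 0` for closed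
components. A linear functional that kills `w` is periodic, hence bounded, along the component.

For two components, take a plane spanned by lattice vectors that contains both periods
(`exists_lattice_plane`) and a functional `f` vanishing on it. Both components lie in some slab `|f|
< |r|`. The union of all components of `τ` contained in this slab is a closed smooth curve, because
components are open in `τ`, and it is invariant under the rank two sublattice. An affine map from
the thickened plane onto the closed slab (`exists_slab_coordinates`) pulls it back to `τ₀`. -/

/-- `γ` is differentiable with unit speed on `I`, and stays in `s` there. -/
def UnitSpeedOn (s : Set Space3) (γ : ℝ → Space3) (I : Set ℝ) : Prop :=
  ∀ t ∈ I, γ t ∈ s ∧ ∃ v : Space3, ‖v‖ = 1 ∧ HasDerivAt γ v t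

/-! ### Arc length charts of a smooth curve. -/

/-- A parametrization `κ` by arc length of a relatively open arc `s ∩ W` of `s` around `p`, with
inverse `coord`. -/
structure ArcChart (s : Set Space3) (p : Space3) where
  ε : ℝ
  ε_pos : 0 < ε
  W : Set Space3
  isOpen : IsOpen W
  base_mem : p ∈ W
  κ : ℝ → Space3
  coord : Space3 → ℝ
  unitSpeed : UnitSpeedOn s κ (Ioo (-ε) ε)
  κ_mem : ∀ t ∈ Ioo (-ε) ε, κ t ∈ W
  coord_κ : ∀ t ∈ Ioo (-ε) ε, coord (κ t) = t
  coord_mem : ∀ q ∈ s, q ∈ W → coord q ∈ Ioo (-ε) ε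
  κ_coord : ∀ q ∈ s, q ∈ W → κ (coord q) = q
  differentiableAt : ∀ q ∈ s, q ∈ W → DifferentiableAt ℝ coord q
  coord_base : coord p = 0

theorem exists_arcLength {c' : ℝ → Space3} {a δ : ℝ} (hδ : 0 < δ)
    (hc' : ContinuousOn c' (Metric.ball a δ)) :
    ∃ ℓ : ℝ → ℝ, ℓ a = 0 ∧ ∀ t ∈ Metric.ball a δ, HasDerivAt ℓ ‖c' t‖ t := by
  refine ⟨fun t => ∫ x in a..t, ‖c' x‖, by simp, fun t ht => ?_⟩
  have hn : ContinuousOn (fun x => ‖c' x‖) (Metric.ball a δ) := hc'.norm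
  have hsub : uIcc a t ⊆ Metric.ball a δ :=
    (convex_ball a δ).ordConnected.uIcc_subset (Metric.mem_ball_self hδ) ht
  exact intervalIntegral.integral_hasDerivAt_right (hn.mono hsub).intervalIntegrable
    (hn.stronglyMeasurableAtFilter Metric.isOpen_ball t ht)
    (hn.continuousAt (Metric.isOpen_ball.mem_nhds ht))

theorem exists_openPartialHomeomorph_of_hasDerivAt {ℓ ℓ' : ℝ → ℝ} {a δ : ℝ} (hδ : 0 < δ)
    (hℓ : ∀ t ∈ Metric.ball a δ, HasDerivAt ℓ (ℓ' t) t)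
    (hc : ContinuousOn ℓ' (Metric.ball a δ)) (h0 : ℓ' a ≠ 0) :
    ∃ L : OpenPartialHomeomorph ℝ ℝ, (L : ℝ → ℝ) = ℓ ∧ a ∈ L.source ∧
      L.source ⊆ Metric.ball a δ := by
  have hstrict : HasStrictDerivAt ℓ (ℓ' a) a :=
    hasStrictDerivAt_of_hasDerivAt_of_continuousAt
      (Filter.mem_of_superset (Metric.ball_mem_nhds a hδ) hℓ)
      (hc.continuousAt (Metric.ball_mem_nhds a hδ))
  let L := (hstrict.hasStrictFDerivAt_equiv h0).toOpenPartialHomeomorph ℓ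
  refine ⟨L.restrOpen (Metric.ball a δ) Metric.isOpen_ball, ?_, ?_, ?_⟩
  · rfl
  · exact ⟨(hstrict.hasStrictFDerivAt_equiv h0).mem_toOpenPartialHomeomorph_source,
      Metric.mem_ball_self hδ⟩
  · exact inter_subset_right

/-- The first axis, pulled back by the straightening chart `Φ`, is a regular curve, which is then
reparametrized by arc length. The inverse `ℓ (Φ q 0)` makes sense off `s` too, so it can be
differentiated as a function on space. -/
theorem exists_arcChart {s : Set Space3} (hs : IsSmoothCurve s) {p : Space3} (hp : p ∈ s) :
    Nonempty (ArcChart s p) := by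
  obtain ⟨Φ, hpΦ, hΦ, hΨ, himg⟩ := hs p hp
  set e : Space3 := EuclideanSpace.single (0 : Fin 3) (1 : ℝ) with he
  have he0 : ∀ t : ℝ, (t • e) 0 = t := fun t => by simp [he]
  have haxis : ∀ q ∈ s, q ∈ Φ.source → Φ q = (Φ q 0) • e := by
    intro q hq hqs
    have h : Φ q ∈ Φ.target ∩ {y | y 1 = 0 ∧ y 2 = 0} := himg ▸ mem_image_of_mem Φ ⟨hq, hqs⟩
    ext i
    fin_cases i
    · simp [he]
    · simpa [he] using h.2.1
    · simpa [he] using h.2.2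
  set a : ℝ := Φ p 0 with ha
  have hopen : IsOpen {t : ℝ | t • e ∈ Φ.target} :=
    Φ.open_target.preimage (by fun_prop : Continuous fun t : ℝ => t • e)
  have hamem : a ∈ {t : ℝ | t • e ∈ Φ.target} := by
    change a • e ∈ Φ.target
    rw [ha, ← haxis p hp hpΦ]; exact Φ.map_source hpΦ
  obtain ⟨δ, hδ, hball⟩ := Metric.isOpen_iff.1 hopen a hamem
  set c : ℝ → Space3 := fun t => Φ.symm (t • e) with hcdef
  have hcs : ∀ t ∈ Metric.ball a δ, c t ∈ s ∧ c t ∈ Φ.source := by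
    intro t ht
    have htt : t • e ∈ Φ.target := hball ht
    have h : t • e ∈ Φ '' (s ∩ Φ.source) := by
      rw [himg]; exact ⟨htt, by simp [he], by simp [he]⟩
    obtain ⟨q, ⟨hq, hqs⟩, hqe⟩ := h
    have : c t = q := by simp only [hcdef]; rw [← hqe, Φ.left_inv hqs]
    rw [this]; exact ⟨hq, hqs⟩
  have hΦc : ∀ t ∈ Metric.ball a δ, Φ (c t) = t • e := fun t ht => Φ.right_inv (hball ht)
  have hcd : ContDiffOn ℝ ∞ c (Metric.ball a δ) :=
    hΨ.comp (by fun_prop : ContDiff ℝ ∞ fun t : ℝ => t • e).contDiffOn fun t ht => hball ht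
  have hcd' := (contDiffOn_infty_iff_deriv_of_isOpen Metric.isOpen_ball).1 hcd
  have hder : ∀ t ∈ Metric.ball a δ, HasDerivAt c (deriv c t) t := fun t ht =>
    (hcd'.1.differentiableAt (Metric.isOpen_ball.mem_nhds ht)).hasDerivAt
  have hΦdiff : ∀ q ∈ Φ.source, DifferentiableAt ℝ Φ q := fun q hq =>
    (hΦ.differentiableOn (by simp)).differentiableAt (Φ.open_source.mem_nhds hq)
  -- `Φ ∘ c` is the linear path `t • e`, so by the chain rule the velocity of `c` cannot vanish.
  have hne : ∀ t ∈ Metric.ball a δ, ‖deriv c t‖ ≠ 0 := by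
    intro t ht h0
    rw [norm_eq_zero] at h0
    have h1 : HasDerivAt (fun u => Φ (c u)) (fderiv ℝ Φ (c t) (deriv c t)) t :=
      (hΦdiff _ (hcs t ht).2).hasFDerivAt.comp_hasDerivAt t (hder t ht)
    have h2 : HasDerivAt (fun u : ℝ => u • e) ((1 : ℝ) • e) t := (hasDerivAt_id t).smul_const e
    have h3 := h1.congr_of_eventuallyEq (f₁ := fun u : ℝ => u • e)
      (Filter.mem_of_superset (Metric.isOpen_ball.mem_nhds ht) fun u hu => (hΦc u hu).symm)
    have h4 := h2.unique h3
    rw [h0, map_zero] at h4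
    simp [he] at h4
  obtain ⟨ℓ, hℓa, hℓ⟩ := exists_arcLength hδ hcd'.2.continuousOn
  obtain ⟨L, hLℓ, haL, hLsub⟩ := exists_openPartialHomeomorph_of_hasDerivAt hδ hℓ
    hcd'.2.continuousOn.norm (hne a (Metric.mem_ball_self hδ))
  have h0t : (0 : ℝ) ∈ L.target := by
    rw [← hℓa, ← hLℓ]; exact L.map_source haL
  obtain ⟨ε, hε, hεsub⟩ := Metric.isOpen_iff.1 L.open_target 0 h0t
  have hIoo : ∀ t ∈ Ioo (-ε) ε, t ∈ L.target := fun t ht =>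
    hεsub (by rw [Real.ball_eq_Ioo]; simpa using ht)
  have hLs : ∀ t ∈ Ioo (-ε) ε, L.symm t ∈ Metric.ball a δ := fun t ht =>
    hLsub (L.map_target (hIoo t ht))
  have hℓL : ∀ t ∈ Ioo (-ε) ε, ℓ (L.symm t) = t := fun t ht => by
    rw [← hLℓ]; exact L.right_inv (hIoo t ht)
  have hsrc : IsOpen (L.source ∩ L ⁻¹' Ioo (-ε) ε) := L.isOpen_inter_preimage isOpen_Ioo
  have hcoord : ∀ q ∈ s, q ∈ Φ.source → Φ q 0 ∈ L.source → c (Φ q 0) = q := by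
    intro q hq hqs hqL
    simp only [hcdef]
    rw [← haxis q hq hqs, Φ.left_inv hqs]
  have hcontΦ : ContinuousOn (fun q => Φ q 0) Φ.source :=
    (by fun_prop : Continuous fun y : Space3 => y 0).comp_continuousOn Φ.continuousOn
  refine ⟨{
    ε := ε
    ε_pos := hε
    W := Φ.source ∩ (fun q => Φ q 0) ⁻¹' (L.source ∩ L ⁻¹' Ioo (-ε) ε)
    isOpen := hcontΦ.isOpen_inter_preimage Φ.open_source hsrc
    base_mem := ⟨hpΦ, haL, by
      change L a ∈ Ioo (-ε) ε
      rw [hLℓ, hℓa]; exact ⟨by linarith, hε⟩⟩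
    κ := fun t => c (L.symm t)
    coord := fun q => ℓ (Φ q 0)
    unitSpeed := ?_
    κ_mem := ?_
    coord_κ := ?_
    coord_mem := ?_
    κ_coord := ?_
    differentiableAt := ?_
    coord_base := hℓa }⟩
  · intro t ht
    refine ⟨(hcs _ (hLs t ht)).1, _, ?_, (hder _ (hLs t ht)).scomp t
      (L.hasDerivAt_symm (hIoo t ht) (hne _ (hLs t ht)) (by rw [hLℓ]; exact hℓ _ (hLs t ht)))⟩
    rw [norm_smul, norm_inv, norm_norm, inv_mul_cancel₀ (hne _ (hLs t ht))]
  · intro t ht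
    refine ⟨(hcs _ (hLs t ht)).2, ?_⟩
    change Φ (c (L.symm t)) 0 ∈ L.source ∩ L ⁻¹' Ioo (-ε) ε
    rw [hΦc _ (hLs t ht), he0]
    refine ⟨L.map_target (hIoo t ht), ?_⟩
    change L (L.symm t) ∈ Ioo (-ε) ε
    rw [L.right_inv (hIoo t ht)]; exact ht
  · intro t ht
    rw [hΦc _ (hLs t ht), he0, hℓL t ht]
  · intro q hq hqW
    have := hqW.2.2
    rw [hLℓ] at this
    exact this
  · intro q hq hqW
    rw [← hLℓ, L.left_inv hqW.2.1, hcoord q hq hqW.1 hqW.2.1]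
  · intro q hq hqW
    have h0 : DifferentiableAt ℝ (fun q => Φ q 0) q := by
      have := (EuclideanSpace.proj (𝕜 := ℝ) (0 : Fin 3)).differentiableAt (x := Φ q)
      exact this.comp q (hΦdiff q hqW.1)
    exact (hℓ _ (hLsub hqW.2.1)).differentiableAt.comp q h0

/-! ### Rigidity of unit speed curves. -/

namespace UnitSpeedOn

variable {s : Set Space3} {α β : ℝ → Space3} {I J : Set ℝ}

theorem mono (h : UnitSpeedOn s α I) (hJ : J ⊆ I) : UnitSpeedOn s α J := fun t ht => h t (hJ ht)

theorem continuousAt (h : UnitSpeedOn s α I) {t : ℝ} (ht : t ∈ I) : ContinuousAt α t := by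
  obtain ⟨-, v, -, hv⟩ := h t ht
  exact hv.continuousAt

theorem of_eventuallyEq {t : ℝ} (hβ : β t ∈ s ∧ ∃ v : Space3, ‖v‖ = 1 ∧ HasDerivAt β v t)
    (h : α =ᶠ[𝓝 t] β) : α t ∈ s ∧ ∃ v : Space3, ‖v‖ = 1 ∧ HasDerivAt α v t := by
  obtain ⟨h1, v, hv, hd⟩ := hβ
  exact ⟨h.eq_of_nhds ▸ h1, v, hv, hd.congr_of_eventuallyEq h⟩

theorem comp_affine (h : UnitSpeedOn s α I) {σ : ℝ} (hσ : σ = 1 ∨ σ = -1) (c : ℝ) :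
    UnitSpeedOn s (fun u => α (c + σ * u)) {u | c + σ * u ∈ I} := by
  intro u hu
  obtain ⟨h1, v, hv, hd⟩ := h _ hu
  refine ⟨h1, σ • v, ?_, ?_⟩
  · rcases hσ with rfl | rfl <;> simp [hv]
  · have : HasDerivAt (fun u : ℝ => c + σ * u) σ u := by
      simpa using ((hasDerivAt_id u).const_mul σ).const_add c
    exact hd.scomp u this

theorem add_const (h : UnitSpeedOn s α I) {w : Space3} (hw : ∀ x ∈ s, x + w ∈ s) :
    UnitSpeedOn s (fun u => α u + w) I := by
  intro u hu
  obtain ⟨h1, v, hv, hd⟩ := h _ hu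
  exact ⟨hw _ h1, v, hv, hd.add_const w⟩

/-- In an arc chart a unit speed curve is an affine reparametrization of the chart. -/
theorem eventually_eq_chart {p : Space3} (A : ArcChart s p) (hI : IsOpen I)
    (h : UnitSpeedOn s α I) {t₀ : ℝ} (ht₀ : t₀ ∈ I) (hW : α t₀ ∈ A.W) :
    ∃ σ : ℝ, (σ = 1 ∨ σ = -1) ∧ ∀ᶠ t in 𝓝 t₀,
      A.coord (α t) = A.coord (α t₀) + σ * (t - t₀) ∧ α t ∈ A.W ∧ α t ∈ s := by
  have hev : ∀ᶠ t in 𝓝 t₀, t ∈ I ∧ α t ∈ A.W :=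
    (hI.eventually_mem ht₀).and ((h.continuousAt ht₀).eventually (A.isOpen.eventually_mem hW))
  obtain ⟨δ, hδ, hball⟩ := Metric.eventually_nhds_iff_ball.1 hev
  have hder : ∀ t ∈ Metric.ball t₀ δ, ∃ d : ℝ, (d = 1 ∨ d = -1) ∧
      HasDerivAt (fun u => A.coord (α u)) d t := by
    intro t ht
    obtain ⟨htI, htW⟩ := hball t ht
    obtain ⟨hts, v, hv, hd⟩ := h t htI
    have h1 : HasDerivAt (fun u => A.coord (α u)) (fderiv ℝ A.coord (α t) v) t :=
      (A.differentiableAt _ hts htW).hasFDerivAt.comp_hasDerivAt t hd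
    refine ⟨_, ?_, h1⟩
    obtain ⟨-, w, hw, hκ⟩ := A.unitSpeed _ (A.coord_mem _ hts htW)
    have h2 := hκ.scomp t h1
    have h3 : (fun u => A.κ (A.coord (α u))) =ᶠ[𝓝 t] α := by
      filter_upwards [Metric.isOpen_ball.mem_nhds ht] with u hu
      exact A.κ_coord _ (h u (hball u hu).1).1 (hball u hu).2
    have h4 := hd.unique (h2.congr_of_eventuallyEq h3.symm)
    -- Both `α` and `κ` have unit speed and `κ ∘ coord ∘ α = α` near `t`, so the coordinate moves at
    -- speed one.
    have h5 : |fderiv ℝ A.coord (α t) v| = 1 := by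
      have := congrArg norm h4
      rw [norm_smul, hw, hv, mul_one, Real.norm_eq_abs] at this
      exact this.symm
    exact eq_or_eq_neg_of_abs_eq h5
  choose! d hd1 hd using hder
  have hcx : Convex ℝ (Metric.ball t₀ δ) := convex_ball t₀ δ
  have h0 : t₀ ∈ Metric.ball t₀ δ := Metric.mem_ball_self hδ
  have hconst : ∀ t ∈ Metric.ball t₀ δ, d t = d t₀ := by
    -- Darboux's theorem: a nowhere zero derivative has constant sign, so no continuity of the
    -- velocity is needed.
    rcases hasDerivWithinAt_forall_lt_or_forall_gt_of_forall_ne hcx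
      (fun t ht => (hd t ht).hasDerivWithinAt) (m := 0)
      (fun t ht => by rcases hd1 t ht with h | h <;> rw [h] <;> norm_num) with hs | hs
    all_goals
      intro t ht
      have a1 := hs t ht
      have a2 := hs t₀ h0
      rcases hd1 t ht with h | h <;> rcases hd1 t₀ h0 with h' | h' <;> rw [h, h'] <;> linarith
  refine ⟨d t₀, hd1 t₀ h0, ?_⟩
  have haff : ∀ t, HasDerivAt (fun t => A.coord (α t₀) + d t₀ * (t - t₀)) (d t₀) t := fun t => by
    simpa using (((hasDerivAt_id t).sub_const t₀).const_mul (d t₀)).const_add (A.coord (α t₀))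
  have heq : EqOn (fun u => A.coord (α u)) (fun t => A.coord (α t₀) + d t₀ * (t - t₀))
      (Metric.ball t₀ δ) := by
    refine Metric.isOpen_ball.eqOn_of_deriv_eq (𝕜 := ℝ) hcx.isPreconnected
      (fun t ht => (hd t ht).differentiableAt.differentiableWithinAt)
      (fun t ht => (haff t).differentiableAt.differentiableWithinAt)
      (fun t ht => ?_) h0 (by simp)
    rw [(hd t ht).deriv, (haff t).deriv, hconst t ht]
  filter_upwards [Metric.ball_mem_nhds t₀ hδ] with t ht
  exact ⟨heq ht, (hball t ht).2, (h t (hball t ht).1).1⟩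

/-- Two unit speed curves through the same point agree locally up to a reflection. -/
theorem eventually_eq_of_eq (hs : IsSmoothCurve s) (hI : IsOpen I) (hJ : IsOpen J)
    (hα : UnitSpeedOn s α I) (hβ : UnitSpeedOn s β J) {a b : ℝ} (ha : a ∈ I) (hb : b ∈ J)
    (hab : α a = β b) :
    ∃ σ : ℝ, (σ = 1 ∨ σ = -1) ∧ ∀ᶠ u in 𝓝 (0 : ℝ), α (a + u) = β (b + σ * u) := by
  obtain ⟨A⟩ := exists_arcChart hs (hα a ha).1
  obtain ⟨σ, hσ, h1⟩ := eventually_eq_chart A hI hα ha A.base_mem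
  obtain ⟨σ', hσ', h2⟩ := eventually_eq_chart A hJ hβ hb (hab ▸ A.base_mem)
  have hmul : σ' * (σ * σ') = σ := by rcases hσ' with rfl | rfl <;> ring
  refine ⟨σ * σ', by rcases hσ with rfl | rfl <;> rcases hσ' with rfl | rfl <;> simp, ?_⟩
  have t1 : Tendsto (fun u : ℝ => a + u) (𝓝 0) (𝓝 a) := by
    have : Continuous fun u : ℝ => a + u := by fun_prop
    simpa using this.tendsto 0
  have t2 : Tendsto (fun u : ℝ => b + σ * σ' * u) (𝓝 0) (𝓝 b) := by
    have : Continuous fun u : ℝ => b + σ * σ' * u := by fun_prop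
    simpa using this.tendsto 0
  filter_upwards [t1.eventually h1, t2.eventually h2] with u hu1 hu2
  rw [← A.κ_coord _ hu1.2.2 hu1.2.1, ← A.κ_coord _ hu2.2.2 hu2.2.1, hu1.1, hu2.1, congrArg A.coord hab]
  congr 1
  rw [← hmul]; ring_nf
  rcases hσ with rfl | rfl <;> rcases hσ' with rfl | rfl <;> ring

/-- The set where the germs agree is open; charts show that it is also closed in the connected set
`I`. -/
theorem eqOn_of_eventuallyEq (hs : IsSmoothCurve s) (hI : IsOpen I) (hIc : IsPreconnected I)
    (hα : UnitSpeedOn s α I) (hβ : UnitSpeedOn s β I) {t₀ : ℝ} (ht₀ : t₀ ∈ I)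
    (h : α =ᶠ[𝓝 t₀] β) : EqOn α β I := by
  have key : I ⊆ {t | α =ᶠ[𝓝 t] β} := by
    refine hIc.subset_of_closure_inter_subset isOpen_setOfPred_eventually_nhds ⟨t₀, ht₀, h⟩ ?_
    rintro t ⟨htc, htI⟩
    by_contra hnot
    have hfreq : ∃ᶠ u in 𝓝 t, α =ᶠ[𝓝 u] β := mem_closure_iff_frequently.1 htc
    have hval : α t = β t := tendsto_nhds_unique_of_frequently_eq (hα.continuousAt htI)
      (hβ.continuousAt htI) (hfreq.mono fun u hu => hu.eq_of_nhds)
    obtain ⟨A⟩ := exists_arcChart hs (hα t htI).1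
    obtain ⟨σ, hσ, h1⟩ := eventually_eq_chart A hI hα htI A.base_mem
    obtain ⟨σ', hσ', h2⟩ := eventually_eq_chart A hI hβ htI (hval ▸ A.base_mem)
    -- If the directions differ, the two curves meet near `t` only at `t` itself, so germs that
    -- agree near `t` must already agree at `t`.
    by_cases hss : σ = σ'
    · refine hnot ?_
      change α =ᶠ[𝓝 t] β
      filter_upwards [h1, h2] with u hu1 hu2
      rw [← A.κ_coord _ hu1.2.2 hu1.2.1, ← A.κ_coord _ hu2.2.2 hu2.2.1, hu1.1, hu2.1, congrArg A.coord hval, hss]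
    · obtain ⟨u, hu, hu1, hu2⟩ := (hfreq.and_eventually (h1.and h2)).exists
      have heq := hu.eq_of_nhds
      have e1 := hu1.1
      rw [heq, hu2.1, congrArg A.coord hval] at e1
      have : (σ' - σ) * (u - t) = 0 := by linarith
      rcases mul_eq_zero.1 this with h0 | h0
      · exact hss (by linarith)
      · have : u = t := by linarith
        rw [this] at hu
        exact hnot hu
  exact fun t ht => (key ht).eq_of_nhds

theorem eq_of_eq (hs : IsSmoothCurve s) (hα : UnitSpeedOn s α univ) (hβ : UnitSpeedOn s β univ)
    {a b : ℝ} (hab : α a = β b) :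
    ∃ σ : ℝ, (σ = 1 ∨ σ = -1) ∧ ∀ u, α (a + u) = β (b + σ * u) := by
  obtain ⟨σ, hσ, h⟩ := eventually_eq_of_eq hs isOpen_univ isOpen_univ hα hβ (mem_univ a)
    (mem_univ b) hab
  refine ⟨σ, hσ, fun u => ?_⟩
  have h1 : UnitSpeedOn s (fun u => α (a + u)) univ := by
    simpa using hα.comp_affine (Or.inl rfl) a
  have h2 : UnitSpeedOn s (fun u => β (b + σ * u)) univ := by
    simpa using hβ.comp_affine hσ b
  exact eqOn_of_eventuallyEq hs isOpen_univ isPreconnected_univ h1 h2 (mem_univ 0) h (mem_univ u)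

end UnitSpeedOn

/-! ### Extension of unit speed arcs to the whole line. -/

namespace UnitSpeedOn

variable {s : Set Space3} {γ : ℝ → Space3} {ε : ℝ}

/-- An arc of radius `ε` centred at a point at most `ε / 2` before the end reaches at least `ε / 2`
beyond it; rigidity makes the two agree on the overlap. -/
theorem exists_extend_right (hs : IsSmoothCurve s) (hε : 0 < ε)
    (hloc : ∀ p ∈ s, ∃ κ : ℝ → Space3, κ 0 = p ∧ UnitSpeedOn s κ (Ioo (-ε) ε)) {a b : ℝ}
    (hab : a < b) (hγ : UnitSpeedOn s γ (Ioo a b)) :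
    ∃ γ' : ℝ → Space3, UnitSpeedOn s γ' (Ioo a (b + ε / 2)) ∧ EqOn γ' γ (Ioo a b) := by
  obtain ⟨t₁, ht₁, hbt⟩ : ∃ t₁ ∈ Ioo a b, b - t₁ ≤ ε / 2 :=
    -- The midpoint keeps `t₁` inside the interval when this is shorter than `ε / 2`.
    ⟨max (b - ε / 2) ((a + b) / 2), ⟨lt_max_of_lt_right (by linarith),
      max_lt (by linarith) (by linarith)⟩, by linarith [le_max_left (b - ε / 2) ((a + b) / 2)]⟩
  obtain ⟨κ, hκ0, hκ⟩ := hloc _ (hγ t₁ ht₁).1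
  obtain ⟨σ, hσ, hev⟩ := eventually_eq_of_eq hs isOpen_Ioo isOpen_Ioo hγ hκ ht₁
    (⟨by linarith, hε⟩ : (0 : ℝ) ∈ Ioo (-ε) ε) hκ0.symm
  set β : ℝ → Space3 := fun t => κ (-(σ * t₁) + σ * t) with hβdef
  have hβ : UnitSpeedOn s β (Ioo (t₁ - ε) (t₁ + ε)) := by
    refine (hκ.comp_affine hσ (-(σ * t₁))).mono fun t ht => ?_
    rcases hσ with rfl | rfl <;> constructor <;> linarith [ht.1, ht.2]
  have hev' : γ =ᶠ[𝓝 t₁] β := by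
    have ht : Tendsto (fun t => t - t₁) (𝓝 t₁) (𝓝 0) := by
      have : Continuous fun t : ℝ => t - t₁ := by fun_prop
      simpa using this.tendsto t₁
    filter_upwards [ht.eventually hev] with t h
    simp only [add_sub_cancel] at h
    rw [h, hβdef]
    ring_nf
  have hag : EqOn γ β (Ioo a b ∩ Ioo (t₁ - ε) (t₁ + ε)) := by
    refine eqOn_of_eventuallyEq hs (isOpen_Ioo.inter isOpen_Ioo) ?_ (hγ.mono inter_subset_left)
      (hβ.mono inter_subset_right) ⟨ht₁, by linarith, by linarith⟩ hev'
    rw [Ioo_inter_Ioo]; exact isPreconnected_Ioo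
  refine ⟨fun t => if t < b then γ t else β t, fun t ht => ?_, fun t ht => if_pos ht.2⟩
  by_cases htb : t < b
  · refine of_eventuallyEq (α := fun t => if t < b then γ t else β t) (hγ t ⟨ht.1, htb⟩) ?_
    filter_upwards [isOpen_Iio.mem_nhds htb] with u hu
    exact if_pos hu
  · have h1 : t ∈ Ioo t₁ (t₁ + ε) := ⟨by linarith [ht₁.2], by linarith [ht.2]⟩
    refine of_eventuallyEq (α := fun t => if t < b then γ t else β t)
      (hβ t ⟨by linarith [h1.1], h1.2⟩) ?_
    filter_upwards [isOpen_Ioo.mem_nhds h1] with u hu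
    by_cases hub : u < b
    · simp only [if_pos hub]
      exact hag ⟨⟨ht₁.1.trans hu.1, hub⟩, by linarith [hu.1], hu.2⟩
    · exact if_neg hub

theorem exists_extend (hs : IsSmoothCurve s) (hε : 0 < ε)
    (hloc : ∀ p ∈ s, ∃ κ : ℝ → Space3, κ 0 = p ∧ UnitSpeedOn s κ (Ioo (-ε) ε)) {b : ℝ}
    (hb : 0 < b) (hγ : UnitSpeedOn s γ (Ioo (-b) b)) :
    ∃ γ' : ℝ → Space3, UnitSpeedOn s γ' (Ioo (-(b + ε / 2)) (b + ε / 2)) ∧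
      EqOn γ' γ (Ioo (-b) b) := by
  obtain ⟨γ₁, h₁, heq₁⟩ := exists_extend_right hs hε hloc (by linarith) hγ
  have h₂ : UnitSpeedOn s (fun u => γ₁ (0 + -1 * u)) (Ioo (-(b + ε / 2)) b) :=
    (h₁.comp_affine (Or.inr rfl) 0).mono fun t ht => ⟨by linarith [ht.2], by linarith [ht.1]⟩
  obtain ⟨γ₃, h₃, heq₃⟩ := exists_extend_right hs hε hloc (by linarith) h₂
  refine ⟨fun u => γ₃ (0 + -1 * u), (h₃.comp_affine (Or.inr rfl) 0).mono fun t ht =>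
    ⟨by linarith [ht.2], by linarith [ht.1]⟩, fun t ht => ?_⟩
  have := heq₃ (x := 0 + -1 * t) ⟨by linarith [ht.2], by linarith [ht.1]⟩
  change γ₃ (0 + -1 * t) = γ t
  rw [this, ← heq₁ ht]
  simp

/-- Each extension gains the same length `ε / 2`, so the intervals exhaust `ℝ`. All stages have the
germ of `κ` at `0`, so they agree where they overlap and glue. -/
theorem exists_complete_of_uniform (hs : IsSmoothCurve s) (hε : 0 < ε)
    (hloc : ∀ p ∈ s, ∃ κ : ℝ → Space3, κ 0 = p ∧ UnitSpeedOn s κ (Ioo (-ε) ε)) {p : Space3}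
    (hp : p ∈ s) : ∃ γ : ℝ → Space3, γ 0 = p ∧ UnitSpeedOn s γ univ := by
  obtain ⟨κ, hκ0, hκ⟩ := hloc p hp
  set h : ℝ := ε / 2 with hh
  have hpos : 0 < h := by positivity
  have key : ∀ n : ℕ, ∃ γ : ℝ → Space3,
      UnitSpeedOn s γ (Ioo (-((n + 1) * h)) ((n + 1) * h)) ∧ γ =ᶠ[𝓝 0] κ := by
    intro n
    induction n with
    | zero =>
      exact ⟨κ, hκ.mono (Ioo_subset_Ioo (by push_cast; linarith) (by push_cast; linarith)),
        EventuallyEq.rfl⟩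
    | succ n ih =>
      obtain ⟨γ, hγ, hev⟩ := ih
      have hb : 0 < ((n : ℝ) + 1) * h := by positivity
      obtain ⟨γ', hγ', heq⟩ := exists_extend hs hε hloc hb hγ
      refine ⟨γ', ?_, ?_⟩
      · have : (((n + 1 : ℕ) : ℝ) + 1) * h = ((n : ℝ) + 1) * h + h := by push_cast; ring
        rwa [this]
      · exact (heq.eventuallyEq_of_mem (Ioo_mem_nhds (by linarith) hb)).trans hev
  choose G hG hGev using key
  have hagree : ∀ {m n : ℕ}, m ≤ n → EqOn (G m) (G n) (Ioo (-((m + 1) * h)) ((m + 1) * h)) := by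
    intro m n hmn
    have hle : ((m : ℝ) + 1) * h ≤ (n + 1) * h := by gcongr
    have hb : 0 < ((m : ℝ) + 1) * h := by positivity
    exact eqOn_of_eventuallyEq hs isOpen_Ioo isPreconnected_Ioo (hG m)
      ((hG n).mono (Ioo_subset_Ioo (by linarith) hle)) (t₀ := 0) ⟨by linarith, hb⟩
      ((hGev m).trans (hGev n).symm)
  have hN : ∀ t : ℝ, t ∈ Ioo (-((⌈|t| / h⌉₊ + 1) * h)) ((⌈|t| / h⌉₊ + 1) * h) := by
    intro t
    rw [mem_Ioo, ← abs_lt, ← div_lt_iff₀ hpos]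
    exact (Nat.le_ceil _).trans_lt (by linarith)
  refine ⟨fun t => G ⌈|t| / h⌉₊ t, ?_, fun t _ => ?_⟩
  · simp only [abs_zero, zero_div, Nat.ceil_zero]
    rw [← hκ0]
    exact (hGev 0).eq_of_nhds
  · refine of_eventuallyEq (α := fun t => G ⌈|t| / h⌉₊ t) (hG ⌈|t| / h⌉₊ t (hN t)) ?_
    filter_upwards [Ioo_mem_nhds (hN t).1 (hN t).2] with u hu
    rcases le_total ⌈|u| / h⌉₊ ⌈|t| / h⌉₊ with hle | hle
    · exact hagree hle (hN u)
    · exact (hagree hle hu).symm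

end UnitSpeedOn

/-! ### Curves with a cocompact group of translations. -/

theorem ArcChart.eventually_mem {s : Set Space3} {p : Space3} (A : ArcChart s p) (hp : p ∈ s)
    {η : ℝ} (hη : 0 < η) : ∀ᶠ q in 𝓝 p, q ∈ A.W ∧ |A.coord q| < η := by
  have h := (A.differentiableAt p hp A.base_mem).continuousAt.abs
  refine (A.isOpen.eventually_mem A.base_mem).and (h.eventually (gt_mem_nhds ?_))
  simpa [A.coord_base] using hη

/-- A group `L` of translations preserves the closed smooth curve `s`, and every point of space is
moved by it into the bounded set `K`. -/
structure IsCocompactCurve (s : Set Space3) (L : AddSubgroup Space3) (K : Set Space3) : Prop where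
  curve : IsSmoothCurve s
  closed : IsClosed s
  add_mem : ∀ w ∈ L, ∀ x ∈ s, x + w ∈ s
  bounded : Bornology.IsBounded K
  exists_add_mem : ∀ x, ∃ w ∈ L, x + w ∈ K

namespace IsCocompactCurve

variable {s K : Set Space3} {L : AddSubgroup Space3}

/-- Half the radius of a chart serves all points near its centre. Compactness of `closure K ∩ s`
leaves finitely many radii, and translations carry the result to all of `s`. -/
theorem exists_uniform (h : IsCocompactCurve s L K) : ∃ ε > 0, ∀ p ∈ s,
    ∃ κ : ℝ → Space3, κ 0 = p ∧ UnitSpeedOn s κ (Ioo (-ε) ε) := by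
  have hcomp : IsCompact (closure K ∩ s) := h.bounded.isCompact_closure.inter_right h.closed
  have key : ∃ ε > 0, ∀ p ∈ closure K ∩ s,
      ∃ κ : ℝ → Space3, κ 0 = p ∧ UnitSpeedOn s κ (Ioo (-ε) ε) := by
    refine hcomp.induction_on (p := fun S => ∃ ε > 0, ∀ p ∈ S,
      ∃ κ : ℝ → Space3, κ 0 = p ∧ UnitSpeedOn s κ (Ioo (-ε) ε)) ⟨1, one_pos, by simp⟩ ?_ ?_ ?_
    · rintro S S' hSS ⟨ε, hε, hS⟩
      exact ⟨ε, hε, fun p hp => hS p (hSS hp)⟩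
    · rintro S S' ⟨ε, hε, hS⟩ ⟨ε', hε', hS'⟩
      refine ⟨min ε ε', lt_min hε hε', fun p hp => ?_⟩
      rcases hp with hp | hp
      · obtain ⟨κ, h0, hκ⟩ := hS p hp
        exact ⟨κ, h0, hκ.mono (Ioo_subset_Ioo (neg_le_neg (min_le_left _ _)) (min_le_left _ _))⟩
      · obtain ⟨κ, h0, hκ⟩ := hS' p hp
        exact ⟨κ, h0, hκ.mono (Ioo_subset_Ioo (neg_le_neg (min_le_right _ _)) (min_le_right _ _))⟩
    · rintro p ⟨-, hp⟩
      obtain ⟨A⟩ := exists_arcChart h.curve hp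
      have hA := A.ε_pos
      refine ⟨{q | q ∈ s ∧ q ∈ A.W ∧ |A.coord q| < A.ε / 2}, ?_, A.ε / 2, by positivity, ?_⟩
      · rw [mem_nhdsWithin_iff_eventually]
        filter_upwards [A.eventually_mem hp (by positivity : 0 < A.ε / 2)] with q hq hqs
        exact ⟨hqs.2, hq⟩
      · rintro q ⟨hqs, hqW, hq⟩
        rw [abs_lt] at hq
        refine ⟨fun u => A.κ (A.coord q + 1 * u), by simpa using A.κ_coord q hqs hqW,
          (A.unitSpeed.comp_affine (Or.inl rfl) (A.coord q)).mono fun u hu => ?_⟩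
        constructor <;> linarith [hu.1, hu.2, hq.1, hq.2]
  obtain ⟨ε, hε, hK⟩ := key
  refine ⟨ε, hε, fun p hp => ?_⟩
  obtain ⟨w, hw, hpw⟩ := h.exists_add_mem p
  obtain ⟨κ, h0, hκ⟩ := hK _ ⟨subset_closure hpw, h.add_mem w hw p hp⟩
  exact ⟨fun u => κ u + -w, by simp [h0],
    hκ.add_const fun x hx => h.add_mem _ (L.neg_mem hw) x hx⟩

theorem exists_complete (h : IsCocompactCurve s L K) {p : Space3} (hp : p ∈ s) :
    ∃ γ : ℝ → Space3, γ 0 = p ∧ UnitSpeedOn s γ univ := by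
  obtain ⟨ε, hε, hloc⟩ := h.exists_uniform
  exact UnitSpeedOn.exists_complete_of_uniform h.curve hε hloc hp

end IsCocompactCurve

/-! ### Components as complete curves, and their periods. -/

namespace UnitSpeedOn

variable {s : Set Space3} {γ β : ℝ → Space3}

theorem continuous (h : UnitSpeedOn s γ univ) : Continuous γ :=
  continuous_iff_continuousAt.2 fun t => h.continuousAt (mem_univ t)

/-- A chart domain meets `s` in a single arc, and `β` runs through that arc with its coordinate
affine in time. -/
theorem eventually_exists_eq (hs : IsSmoothCurve s) (hβ : UnitSpeedOn s β univ) {η : ℝ}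
    (hη : 0 < η) : ∀ᶠ q in 𝓝[s] (β 0), ∃ u, |u| < η ∧ β u = q := by
  have h0 := (hβ 0 (mem_univ 0)).1
  obtain ⟨A⟩ := exists_arcChart hs h0
  obtain ⟨σ, hσ, hev⟩ := eventually_eq_chart A isOpen_univ hβ (mem_univ 0) A.base_mem
  obtain ⟨δ, hδ, hball⟩ := Metric.eventually_nhds_iff_ball.1 hev
  rw [eventually_nhdsWithin_iff]
  filter_upwards [A.eventually_mem h0 (lt_min hη hδ)] with q hq hqs
  have habs : |σ * A.coord q| = |A.coord q| := by rcases hσ with rfl | rfl <;> simp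
  have hu := hball (σ * A.coord q)
    (by rw [Metric.mem_ball, Real.dist_eq, sub_zero, habs]; exact hq.2.trans_le (min_le_right _ _))
  refine ⟨σ * A.coord q, habs ▸ hq.2.trans_le (min_le_left _ _), ?_⟩
  have hc : A.coord (β (σ * A.coord q)) = A.coord q := by
    rw [hu.1, A.coord_base]
    rcases hσ with rfl | rfl <;> ring
  rw [← A.κ_coord _ hu.2.2 hu.2.1, hc, A.κ_coord q hqs hq.1]

theorem range_subset_component (hγ : UnitSpeedOn s γ univ) (t : ℝ) :
    range γ ⊆ connectedComponentIn s (γ t) := by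
  rw [← image_univ]
  exact (isPreconnected_univ.image γ hγ.continuous.continuousOn).subset_connectedComponentIn
    ⟨t, mem_univ t, rfl⟩ (by rintro _ ⟨u, hu, rfl⟩; exact (hγ u hu).1)

theorem range_subset_range (hs : IsSmoothCurve s) (hγ : UnitSpeedOn s γ univ)
    (hβ : UnitSpeedOn s β univ) {a b : ℝ} (hab : β a = γ b) : range β ⊆ range γ := by
  obtain ⟨σ, -, h⟩ := eq_of_eq hs hβ hγ hab
  rintro _ ⟨u, rfl⟩
  exact ⟨b + σ * (u - a), by rw [← h, add_sub_cancel]⟩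

end UnitSpeedOn

namespace IsCocompactCurve

variable {s K : Set Space3} {L : AddSubgroup Space3} {γ : ℝ → Space3}

/-- Lying on `γ` is a locally constant property on `s`: near each point `s` is covered by one
complete curve, and complete curves that meet have the same range. -/
theorem component_subset_range (h : IsCocompactCurve s L K) (hγ : UnitSpeedOn s γ univ) (t : ℝ) :
    connectedComponentIn s (γ t) ⊆ range γ := by
  intro y hy
  have hts := (hγ t (mem_univ t)).1
  have key := isPreconnected_connectedComponentIn.induction₂ (s := connectedComponentIn s (γ t))
    (fun x y => x ∈ range γ ↔ y ∈ range γ) (fun x hx => ?_) (fun x y z _ _ _ => Iff.trans)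
    (fun x y _ _ => Iff.symm) (mem_connectedComponentIn hts) hy
  · exact key.1 ⟨t, rfl⟩
  · have hxs := connectedComponentIn_subset _ _ hx
    obtain ⟨β, rfl, hβ⟩ := h.exists_complete hxs
    filter_upwards [nhdsWithin_mono _ (connectedComponentIn_subset _ _)
      (hβ.eventually_exists_eq h.curve one_pos)] with y hy
    obtain ⟨u, -, rfl⟩ := hy
    constructor
    · rintro ⟨b, hb⟩
      exact hγ.range_subset_range h.curve hβ hb.symm ⟨u, rfl⟩
    · rintro ⟨b, hb⟩
      exact hγ.range_subset_range h.curve hβ hb.symm ⟨0, rfl⟩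

theorem eventually_component_eq (h : IsCocompactCurve s L K) {p : Space3} (hp : p ∈ s) :
    ∀ᶠ q in 𝓝[s] p, connectedComponentIn s q = connectedComponentIn s p := by
  obtain ⟨β, rfl, hβ⟩ := h.exists_complete hp
  filter_upwards [hβ.eventually_exists_eq h.curve one_pos] with q hq
  obtain ⟨u, -, rfl⟩ := hq
  exact (connectedComponentIn_eq (hβ.range_subset_component 0 ⟨u, rfl⟩)).symm

/-- Pigeonhole in the quotient by `L`: the curve returns to the same short arc, and rigidity turns
this return into a translation symmetry of the whole curve. -/
theorem exists_period (h : IsCocompactCurve s L K) (hγ : UnitSpeedOn s γ univ) :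
    ∃ T ≠ 0, ∃ w ∈ L, ∀ u, γ (u + T) = γ u + w := by
  choose w hwL hwK using fun n : ℕ => h.exists_add_mem (γ n)
  obtain ⟨p, -, φ, hφ, hlim⟩ := tendsto_subseq_of_bounded h.bounded hwK
  have hmem : ∀ n : ℕ, γ n + w n ∈ s := fun n => h.add_mem _ (hwL n) _ (hγ n (mem_univ _)).1
  have hps : p ∈ s := h.closed.mem_of_tendsto hlim (Eventually.of_forall fun k => hmem (φ k))
  obtain ⟨β, rfl, hβ⟩ := h.exists_complete hps
  have hlim' := tendsto_nhdsWithin_of_tendsto_nhds_of_eventually_within _ hlim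
    (Eventually.of_forall fun k => hmem (φ k))
  obtain ⟨k, hk⟩ := eventually_atTop.1
    -- With `|u₁|, |u₂| < 1 / 4` the correction along the arc is below `1 / 2`, while the integers
    -- `m < n` differ by at least `1`; hence `a < n` and the period is nonzero.
    (hlim'.eventually (hβ.eventually_exists_eq h.curve (by norm_num : (0 : ℝ) < 1 / 4)))
  obtain ⟨u₁, hu₁, e₁⟩ := hk k le_rfl
  obtain ⟨u₂, hu₂, e₂⟩ := hk (k + 1) (by omega)
  have hlt : φ k < φ (k + 1) := hφ (by omega)
  simp only [Function.comp_apply] at e₁ e₂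
  generalize φ k = m at *
  generalize φ (k + 1) = n at *
  have hw₁ : UnitSpeedOn s (fun u => γ u + w m) univ := hγ.add_const (h.add_mem _ (hwL m))
  obtain ⟨σ, hσ, h₁⟩ := hw₁.eq_of_eq h.curve hβ e₁.symm
  have h₂ := h₁ (σ * (u₂ - u₁))
  have hσσ : u₁ + σ * (σ * (u₂ - u₁)) = u₂ := by rcases hσ with rfl | rfl <;> ring
  rw [hσσ, e₂] at h₂
  set a : ℝ := m + σ * (u₂ - u₁) with ha
  have han : a < n := by
    have : (m : ℝ) + 1 ≤ n := by exact_mod_cast hlt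
    rw [abs_lt] at hu₁ hu₂
    rcases hσ with rfl | rfl <;> rw [ha] <;> linarith
  have hL : w m - w n ∈ L := L.sub_mem (hwL m) (hwL n)
  have hw₂ : UnitSpeedOn s (fun u => γ u + (w m - w n)) univ := hγ.add_const (h.add_mem _ hL)
  have h₃ : γ a + (w m - w n) = γ n := by
    rw [← add_sub_assoc, h₂, add_sub_cancel_right]
  obtain ⟨σ', hσ', h₄⟩ := hw₂.eq_of_eq h.curve hγ h₃
  rcases hσ' with rfl | rfl
  · refine ⟨n - a, by linarith, w m - w n, hL, fun u => ?_⟩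
    have := h₄ (u - a)
    rw [add_sub_cancel] at this
    rw [this]
    ring_nf
  · exfalso
    -- The reflection fixes the parameter `c`, so the translation is zero and `γ` is symmetric about
    -- `c`; its velocity there equals its own negative, against unit speed.
    set c : ℝ := (a + n) / 2 with hc
    have e₃ := h₄ (c - a)
    have : (n : ℝ) + -1 * (c - a) = c := by rw [hc]; ring
    rw [this, add_sub_cancel, add_eq_left] at e₃
    obtain ⟨-, v, hv, hd⟩ := hγ c (mem_univ c)
    have hsym : (fun u => γ (2 * c - u)) = γ := by
      funext u
      have e₄ := h₄ (2 * c - u - a)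
      rw [e₃, add_sub_cancel, add_zero] at e₄
      rw [e₄]
      congr 1
      rw [hc]; ring
    have hd' : HasDerivAt (fun u => γ (2 * c - u)) ((-1 : ℝ) • v) c := by
      have hc2 : 2 * c - c = c := by ring
      exact (hc2.symm ▸ hd : HasDerivAt γ v (2 * c - c)).scomp c
        ((hasDerivAt_id c).const_sub (2 * c))
    rw [hsym] at hd'
    have hvv := hd.unique hd'
    rw [neg_one_smul, eq_neg_iff_add_eq_zero, ← two_smul ℝ, smul_eq_zero] at hvv
    simp [hvv.resolve_left two_ne_zero] at hv

/-- A component is contained in every slab, thick enough, that is parallel to a suitable lattice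
vector. -/
theorem exists_component_bounded (h : IsCocompactCurve s L K) {p : Space3} (hp : p ∈ s) :
    ∃ w ∈ L, ∀ f : Space3 →L[ℝ] ℝ, f w = 0 → ∃ R, ∀ y ∈ connectedComponentIn s p, |f y| ≤ R := by
  obtain ⟨γ, rfl, hγ⟩ := h.exists_complete hp
  obtain ⟨T, hT, w, hw, hper⟩ := h.exists_period hγ
  refine ⟨w, hw, fun f hf => ?_⟩
  have hp : Function.Periodic (fun u => f (γ u)) T := fun u => by simp [hper u, hf]
  obtain ⟨R, hR⟩ := (hp.compact_of_continuous hT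
    (f.continuous.comp hγ.continuous)).isBounded.exists_norm_le
  refine ⟨R, fun y hy => ?_⟩
  obtain ⟨u, rfl⟩ := h.component_subset_range hγ 0 hy
  exact hR _ ⟨u, rfl⟩

end IsCocompactCurve

/-! ### Smooth curves and unions of components -/

theorem IsSmoothCurve.inter_isOpen {s O : Set Space3} (hs : IsSmoothCurve s) (hO : IsOpen O) :
    IsSmoothCurve (s ∩ O) := by
  rintro p ⟨hp, hpO⟩
  obtain ⟨Φ, hpΦ, hΦ, hΨ, himg⟩ := hs p hp
  refine ⟨Φ.restrOpen O hO, ⟨hpΦ, hpO⟩, hΦ.mono inter_subset_left, hΨ.mono inter_subset_left, ?_⟩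
  ext y
  constructor
  · rintro ⟨q, ⟨⟨hq, -⟩, hqs⟩, rfl⟩
    have h : Φ q ∈ Φ.target ∩ {y | y 1 = 0 ∧ y 2 = 0} := himg ▸ mem_image_of_mem Φ ⟨hq, hqs.1⟩
    exact ⟨(Φ.restrOpen O hO).map_source hqs, h.2⟩
  · rintro ⟨hy, hy0⟩
    have h : y ∈ Φ '' (s ∩ Φ.source) := himg ▸ ⟨hy.1, hy0⟩
    obtain ⟨q, ⟨hq, hqs⟩, rfl⟩ := h
    have hqO : q ∈ O := by
      have := ((Φ.restrOpen O hO).map_target hy).2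
      change Φ.symm (Φ q) ∈ O at this
      rwa [Φ.left_inv hqs] at this
    exact ⟨q, ⟨⟨hq, hqO⟩, hqs, hqO⟩, rfl⟩

theorem IsSmoothCurve.preimage {s : Set Space3} (hs : IsSmoothCurve s) (T : Space3 ≃ₜ Space3)
    (hT : ContDiff ℝ ∞ T) (hT' : ContDiff ℝ ∞ T.symm) : IsSmoothCurve (T ⁻¹' s) := by
  intro p hp
  obtain ⟨Φ, hpΦ, hΦ, hΨ, himg⟩ := hs (T p) hp
  refine ⟨T.transOpenPartialHomeomorph Φ, hpΦ, hΦ.comp hT.contDiffOn fun q hq => hq,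
    hT'.comp_contDiffOn hΨ, ?_⟩
  change (Φ ∘ T) '' (T ⁻¹' s ∩ T ⁻¹' Φ.source) = _
  rw [image_comp, ← preimage_inter, image_preimage_eq _ T.surjective, himg]
  rfl

namespace IsCocompactCurve

variable {s K : Set Space3} {L : AddSubgroup Space3}

/-- Components are open in `s`, so a union of them is cut out of `s` by an open set of the ambient
space. -/
theorem curve_union_components (h : IsCocompactCurve s L K) (Q : Set Space3 → Prop) :
    IsSmoothCurve {q | q ∈ s ∧ Q (connectedComponentIn s q)} := by
  set N := {q | q ∈ s ∧ Q (connectedComponentIn s q)} with hN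
  have hNO : N = s ∩ interior (N ∪ sᶜ) := by
    ext q
    refine ⟨fun hq => ⟨hq.1, mem_interior_iff_mem_nhds.2 ?_⟩, fun hq => ?_⟩
    · filter_upwards [eventually_nhdsWithin_iff.1 (h.eventually_component_eq hq.1)] with y hy
      by_cases hys : y ∈ s
      · exact Or.inl ⟨hys, (hy hys).symm ▸ hq.2⟩
      · exact Or.inr hys
    · exact (interior_subset hq.2).resolve_right (not_not.2 hq.1)
  rw [hNO]
  exact h.curve.inter_isOpen isOpen_interior

theorem closed_union_components (h : IsCocompactCurve s L K) (Q : Set Space3 → Prop) :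
    IsClosed {q | q ∈ s ∧ Q (connectedComponentIn s q)} := by
  refine isClosed_of_closure_subset fun q hq => ?_
  have hqs : q ∈ s := h.closed.closure_subset_iff.2 (fun x hx => hx.1) hq
  obtain ⟨y, hy, hy'⟩ := ((mem_closure_iff_frequently.1 hq).and_eventually
    (eventually_nhdsWithin_iff.1 (h.eventually_component_eq hqs))).exists
  exact ⟨hqs, hy' hy.1 ▸ hy.2⟩

end IsCocompactCurve

theorem connectedComponentIn_union_components {X : Type*} [TopologicalSpace X] {s : Set X}
    {Q : Set X → Prop} {x : X} (hx : x ∈ s) (hQ : Q (connectedComponentIn s x)) :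
    connectedComponentIn {q | q ∈ s ∧ Q (connectedComponentIn s q)} x =
      connectedComponentIn s x := by
  refine (connectedComponentIn_mono x fun q hq => hq.1).antisymm ?_
  refine isPreconnected_connectedComponentIn.subset_connectedComponentIn
    (mem_connectedComponentIn hx) fun q hq => ⟨connectedComponentIn_subset _ _ hq, ?_⟩
  rwa [← connectedComponentIn_eq hq]

theorem connectedComponentIn_add {s : Set Space3} {w : Space3} (hw : ∀ x ∈ s, x + w ∈ s)
    (hw' : ∀ x ∈ s, x + -w ∈ s) {x : Space3} (hx : x ∈ s) :
    connectedComponentIn s (x + w) = (· + w) '' connectedComponentIn s x := by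
  have hs : (Homeomorph.addRight w) '' s = s := by
    ext y
    refine ⟨?_, fun hy => ⟨y + -w, hw' y hy, by simp⟩⟩
    rintro ⟨z, hz, rfl⟩
    exact hw z hz
  have := (Homeomorph.addRight w).image_connectedComponentIn hx
  rw [hs] at this
  exact this.symm

theorem IsTangleComponent.preimage {C s : Set Space3} (h : IsTangleComponent C s)
    (T : Space3 ≃ₜ Space3) : IsTangleComponent (T ⁻¹' C) (T ⁻¹' s) := by
  obtain ⟨x, hx, rfl⟩ := h
  refine ⟨T.symm x, by simpa using hx, ?_⟩
  rw [← T.image_symm, T.symm.image_connectedComponentIn hx]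

/-! ### Integral combinations of vectors -/

/-- The homomorphism from `ℤⁿ` that maps the standard basis to `v`. -/
def latticeHom {n : ℕ} {A : Type*} [AddCommGroup A] (v : Fin n → A) : (Fin n → ℤ) →+ A where
  toFun m := ∑ i, m i • v i
  map_zero' := by simp
  map_add' m m' := by simp [add_smul, Finset.sum_add_distrib]

theorem latticeHom_apply {n : ℕ} {A : Type*} [AddCommGroup A] (v : Fin n → A) (m : Fin n → ℤ) :
    latticeHom v m = ∑ i, m i • v i := rfl

theorem map_latticeHom {n : ℕ} {A B F : Type*} [AddCommGroup A] [AddCommGroup B] [FunLike F A B]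
    [AddMonoidHomClass F A B] (φ : F) (v : Fin n → A) (m : Fin n → ℤ) :
    φ (latticeHom v m) = latticeHom (fun i => φ (v i)) m := by
  simp [latticeHom_apply, map_sum, map_zsmul]

theorem latticeHom_single {n : ℕ} {A : Type*} [AddCommGroup A] (v : Fin n → A) (i : Fin n) :
    latticeHom v (Pi.single i 1) = v i := by
  simp [latticeHom_apply, Pi.single_apply, ite_smul]

theorem latticeHom_injective {n : ℕ} {v : Fin n → Space3} (hv : LinearIndependent ℝ v) :
    Function.Injective (latticeHom v) := by
  rw [injective_iff_map_eq_zero]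
  intro m hm
  funext i
  have := Fintype.linearIndependent_iff.1 hv (fun i => (m i : ℝ))
    (by simpa only [Int.cast_smul_eq_zsmul, latticeHom_apply] using hm) i
  exact_mod_cast this

theorem exists_latticeHom_add_mem {v : Fin 3 → Space3} (hv : LinearIndependent ℝ v) :
    ∃ K : Set Space3, Bornology.IsBounded K ∧ ∀ x, ∃ w ∈ (latticeHom v).range, x + w ∈ K := by
  set b := basisOfLinearIndependentOfCardEqFinrank hv (by simp) with hb
  have hbv : ⇑b = v := coe_basisOfLinearIndependentOfCardEqFinrank hv _
  refine ⟨ZSpan.fundamentalDomain b, ZSpan.fundamentalDomain_isBounded b, fun x => ?_⟩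
  refine ⟨-latticeHom v (fun i => ⌊b.repr x i⌋), neg_mem ⟨_, rfl⟩, ?_⟩
  have : x + -latticeHom v (fun i => ⌊b.repr x i⌋) = ZSpan.fract b x := by
    rw [ZSpan.fract_apply, ← sub_eq_add_neg, latticeHom_apply, ← hbv]
    simp [ZSpan.floor]
  rw [this]
  exact ZSpan.fract_mem_fundamentalDomain b x

theorem exists_linearIndependent_pair {v : Fin 3 → Space3} (hv : LinearIndependent ℝ v)
    {x : Space3} (hx : x ≠ 0) : ∃ i, LinearIndependent ℝ ![x, v i] := by
  by_contra! hcon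
  have hle : Submodule.span ℝ (range v) ≤ Submodule.span ℝ {x} := by
    rw [Submodule.span_le]
    rintro _ ⟨i, rfl⟩
    have := hcon i
    rw [LinearIndependent.pair_iff' hx] at this
    push Not at this
    exact Submodule.mem_span_singleton.2 this
  have := Submodule.finrank_mono hle
  rw [finrank_span_eq_card hv, finrank_span_singleton hx] at this
  simp at this

/-- Any two lattice vectors lie in a plane spanned by two lattice vectors. -/
theorem exists_lattice_plane {v : Fin 3 → Space3} (hv : LinearIndependent ℝ v)
    (m₁ m₂ : Fin 3 → ℤ) : ∃ u : Fin 2 → Fin 3 → ℤ,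
      LinearIndependent ℝ (fun i => latticeHom v (u i)) ∧
      ∀ f : Space3 →L[ℝ] ℝ, (∀ i, f (latticeHom v (u i)) = 0) →
        f (latticeHom v m₁) = 0 ∧ f (latticeHom v m₂) = 0 := by
  have hvec : ∀ a b : Fin 3 → ℤ, (fun i => latticeHom v ((![a, b] : Fin 2 → Fin 3 → ℤ) i)) =
      ![latticeHom v a, latticeHom v b] := by
    intro a b
    funext i
    fin_cases i <;> rfl
  by_cases h : LinearIndependent ℝ ![latticeHom v m₁, latticeHom v m₂]
  · exact ⟨![m₁, m₂], by rwa [hvec], fun f hf => ⟨hf 0, hf 1⟩⟩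
  -- In the dependent case, which includes zero periods, both vectors are multiples of one nonzero
  -- lattice vector, and some `v i` completes it to a plane.
  · obtain ⟨m, hm, ⟨a₁, h₁⟩, a₂, h₂⟩ : ∃ m, latticeHom v m ≠ 0 ∧
        (∃ a : ℝ, a • latticeHom v m = latticeHom v m₁) ∧
        ∃ a : ℝ, a • latticeHom v m = latticeHom v m₂ := by
      by_cases h₁ : latticeHom v m₁ = 0
      · by_cases h₂ : latticeHom v m₂ = 0
        · exact ⟨Pi.single 0 1, by rw [latticeHom_single]; exact hv.ne_zero 0,
            ⟨0, by simp [h₁]⟩, 0, by simp [h₂]⟩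
        · exact ⟨m₂, h₂, ⟨0, by simp [h₁]⟩, 1, one_smul _ _⟩
      · rw [LinearIndependent.pair_iff' h₁] at h
        push Not at h
        exact ⟨m₁, h₁, ⟨1, one_smul _ _⟩, h⟩
    obtain ⟨i, hi⟩ := exists_linearIndependent_pair hv hm
    refine ⟨![m, Pi.single i 1], by rwa [hvec, latticeHom_single], fun f hf => ?_⟩
    have h0 : f (latticeHom v m) = 0 := hf 0
    rw [← h₁, ← h₂, map_smul, map_smul, h0]
    simp

/-! ### The thickened plane and its affine embeddings -/

/-- The two horizontal unit vectors. -/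
noncomputable def horizontalBasis : Fin 2 → Space3 :=
  ![EuclideanSpace.single 0 1, EuclideanSpace.single 1 1]

theorem horizontalBasis_linearIndependent : LinearIndependent ℝ horizontalBasis := by
  rw [horizontalBasis, LinearIndependent.pair_iff]
  intro a b h
  have h0 := congrArg (fun y : Space3 => y 0) h
  have h1 := congrArg (fun y : Space3 => y 1) h
  simp at h0 h1
  exact ⟨h0, h1⟩

theorem latticeHom_horizontalBasis_two (m : Fin 2 → ℤ) :
    latticeHom horizontalBasis m 2 = 0 := by
  simp [latticeHom_apply, horizontalBasis, Fin.sum_univ_two]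

/-- The action of `ℤ²` on the thickened plane by horizontal integral translations. -/
noncomputable def horizontalAction : Multiplicative (Fin 2 → ℤ) →* (thickenedPlane ≃ᵢ thickenedPlane) where
  toFun g :=
    { toFun := fun x => ⟨x + latticeHom horizontalBasis g.toAdd, by
        have := x.2
        simpa [thickenedPlane, latticeHom_horizontalBasis_two] using this⟩
      invFun := fun x => ⟨x - latticeHom horizontalBasis g.toAdd, by
        have := x.2
        simpa [thickenedPlane, latticeHom_horizontalBasis_two] using this⟩
      left_inv := fun x => by simp
      right_inv := fun x => by simp
      isometry_toFun := Isometry.of_dist_eq fun x y => by simp [Subtype.dist_eq] }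
  map_one' := by ext1 x; simp
  map_mul' g h := by
    ext1 x
    simp only [IsometryEquiv.mul_apply]
    refine Subtype.ext ?_
    change (x : Space3) + latticeHom horizontalBasis (g.toAdd + h.toAdd) =
      (x : Space3) + latticeHom horizontalBasis h.toAdd + latticeHom horizontalBasis g.toAdd
    rw [map_add]
    abel

theorem horizontalAction_apply (g : Multiplicative (Fin 2 → ℤ)) (x : thickenedPlane) :
    (horizontalAction g x : Space3) = x + latticeHom horizontalBasis g.toAdd := rfl

theorem isTranslational_horizontalAction : IsTranslational horizontalAction :=
  ⟨horizontalBasis, horizontalBasis_linearIndependent, fun _ _ => rfl⟩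

theorem openSlab_subset_interior :
    {x : Space3 | x 2 ∈ Ioo (0 : ℝ) 1} ⊆ interior thickenedPlane :=
  interior_maximal (fun _ hx => Ioo_subset_Icc_self hx)
    (isOpen_Ioo.preimage (by fun_prop : Continuous fun x : Space3 => x 2))

/-- A convex set with interior points. This makes `fderivWithin` unique up to the boundary, so the
Jacobian of an affine map is its linear part. -/
theorem uniqueDiffOn_thickenedPlane : UniqueDiffOn ℝ thickenedPlane := by
  refine uniqueDiffOn_convex ?_ ⟨EuclideanSpace.single 2 (1 / 2), openSlab_subset_interior ?_⟩
  · exact (convex_Icc (0 : ℝ) 1).linear_preimage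
      (EuclideanSpace.proj (𝕜 := ℝ) (2 : Fin 3) : Space3 →L[ℝ] ℝ).toLinearMap
  · constructor <;> norm_num

theorem isOrientedEmbedding_affine (M : Space3 ≃L[ℝ] Space3)
    (hM : 0 < (M : Space3 →L[ℝ] Space3).det) (t : Space3) :
    IsOrientedEmbedding fun x => M x + t where
  isEmbedding := ((M.toHomeomorph.trans (Homeomorph.addRight t)).isEmbedding).comp
    Topology.IsEmbedding.subtypeVal
  smooth := by
    refine ⟨fun x => M x + t, fun _ => rfl, (M.contDiff.add contDiff_const).contDiffOn,
      fun x hx => ?_⟩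
    have : HasFDerivAt (fun x => M x + t) (M : Space3 →L[ℝ] Space3) x :=
      M.hasFDerivAt.add_const t
    rwa [this.hasFDerivWithinAt.fderivWithin (uniqueDiffOn_thickenedPlane x hx)]

/-- Linear coordinates on an arbitrarily thick slab parallel to a given plane. -/
theorem exists_slab_coordinates {a : Fin 2 → Space3} (ha : LinearIndependent ℝ a) :
    ∃ f : Space3 →L[ℝ] ℝ, (∀ i, f (a i) = 0) ∧ ∀ R : ℝ, ∃ (r : ℝ) (M : Space3 ≃L[ℝ] Space3)
      (t : Space3), 0 < |r| ∧ R < |r| ∧ 0 < (M : Space3 →L[ℝ] Space3).det ∧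
        (∀ i, M (horizontalBasis i) = a i) ∧ (∀ x, f (M x) = 2 * r * x 2) ∧ f t = -r := by
  obtain ⟨z, hz⟩ := exists_linearIndependent_snoc_of_lt_finrank (R := ℝ) ha (by simp)
  set b := basisOfLinearIndependentOfCardEqFinrank hz (by simp) with hb
  have hbz : ⇑b = Fin.snoc a z := coe_basisOfLinearIndependentOfCardEqFinrank hz _
  set e := (EuclideanSpace.basisFun (Fin 3) ℝ).toBasis with he
  have hei : ∀ i, e i = EuclideanSpace.single i 1 := fun i => by simp [he]
  set B : Space3 ≃ₗ[ℝ] Space3 := e.equiv b (Equiv.refl _) with hB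
  have hBe : ∀ i, B (e i) = b i := fun i => by simp [hB]
  have hBa : ∀ i : Fin 2, B (horizontalBasis i) = a i := by
    intro i
    fin_cases i
    · change B (EuclideanSpace.single 0 1) = a 0
      rw [← hei, hBe, hbz]; rfl
    · change B (EuclideanSpace.single 1 1) = a 1
      rw [← hei, hBe, hbz]; rfl
  set f : Space3 →L[ℝ] ℝ :=
    (EuclideanSpace.proj (𝕜 := ℝ) (2 : Fin 3)).comp
      (B.symm.toContinuousLinearEquiv : Space3 →L[ℝ] Space3) with hf
  have hfB : ∀ x, f (B x) = x 2 := fun x => by simp [hf]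
  refine ⟨f, fun i => ?_, fun R => ?_⟩
  · rw [← hBa, hfB]
    fin_cases i <;> simp [horizontalBasis]
  have hdetB : LinearMap.det (B : Space3 →ₗ[ℝ] Space3) ≠ 0 := B.isUnit_det'.ne_zero
  -- The sign of `r` is that of `det B`, so that stretching the third axis by `2 * r` yields a
  -- positive determinant.
  obtain ⟨r, hrpos, hr, hdet⟩ : ∃ r : ℝ, 0 < |r| ∧ R < |r| ∧
      0 < LinearMap.det (B : Space3 →ₗ[ℝ] Space3) * (2 * r) := by
    have h1 : 0 < |R| + 1 := by positivity
    have h2 : R < |R| + 1 := by linarith [le_abs_self R]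
    rcases hdetB.lt_or_gt with h | h
    · refine ⟨-(|R| + 1), ?_, ?_, mul_pos_of_neg_of_neg h (by linarith)⟩ <;>
        rwa [abs_neg, abs_of_pos h1]
    · refine ⟨|R| + 1, ?_, ?_, by positivity⟩ <;> rwa [abs_of_pos h1]
  set D : Space3 →ₗ[ℝ] Space3 := Matrix.toLin e e (Matrix.diagonal ![1, 1, 2 * r]) with hD
  have hDdet : LinearMap.det D = 2 * r := by
    rw [hD, LinearMap.det_toLin, Matrix.det_diagonal, Fin.prod_univ_three]
    simp
  have hDapp : ∀ x i, D x i = (![1, 1, 2 * r] : Fin 3 → ℝ) i * x i := by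
    intro x i
    have : e.repr (D x) i = (![1, 1, 2 * r] : Fin 3 → ℝ) i * e.repr x i := by
      rw [hD, Matrix.repr_toLin, Matrix.mulVec_diagonal]
    simpa [he] using this
  have hcomp : LinearMap.det ((B : Space3 →ₗ[ℝ] Space3) ∘ₗ D) =
      LinearMap.det (B : Space3 →ₗ[ℝ] Space3) * (2 * r) := by
    rw [LinearMap.det_comp, hDdet]
  set M := (LinearMap.equivOfDetNeZero _ (hcomp ▸ hdet.ne')).toContinuousLinearEquiv with hM
  have hMapp : ∀ x, M x = B (D x) := fun x => rfl
  refine ⟨r, M, B (EuclideanSpace.single 2 (-r)), hrpos, hr, ?_, fun i => ?_, fun x => ?_, ?_⟩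
  · rw [← hcomp] at hdet
    exact hdet
  · rw [hMapp, ← hBa]
    congr 1
    ext k
    rw [hDapp]
    fin_cases i <;> fin_cases k <;> simp [horizontalBasis]
  · rw [hMapp, hfB, hDapp]
    simp
  · rw [hfB]
    simp

/-! ### Construction of the doubly periodic tangle. -/

namespace IsTriplyPeriodicTangle

variable {σ : Multiplicative (Fin 3 → ℤ) →* ((univ : Set Space3) ≃ᵢ (univ : Set Space3))}
  {τ : Set Space3}

theorem exists_isCocompactCurve (hτ : IsTriplyPeriodicTangle σ τ) :
    ∃ v : Fin 3 → Space3, LinearIndependent ℝ v ∧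
      (∀ g x, (σ g x : Space3) = x + latticeHom v g.toAdd) ∧
      ∃ K, IsCocompactCurve τ (latticeHom v).range K := by
  obtain ⟨v, hv, hσ⟩ := hτ.translational
  obtain ⟨K, hK, hcover⟩ := exists_latticeHom_add_mem hv
  refine ⟨v, hv, fun g x => hσ g.toAdd x, K, hτ.curve, ?_, ?_, hK, hcover⟩
  · have := isClosed_univ.isClosedEmbedding_subtypeVal.isClosedMap _ hτ.closed
    rwa [Subtype.image_preimage_coe, univ_inter] at this
  · rintro _ ⟨m, rfl⟩ x hx
    have h : σ (Multiplicative.ofAdd m) ⟨x, mem_univ x⟩ ∈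
        σ (Multiplicative.ofAdd m) '' ((↑) ⁻¹' τ) := mem_image_of_mem _ hx
    rw [hτ.preserved] at h
    have h' : (σ (Multiplicative.ofAdd m) ⟨x, mem_univ x⟩ : Space3) ∈ τ := h
    rwa [hσ] at h'

end IsTriplyPeriodicTangle

theorem mainTheorem6
    (σ : Multiplicative (Fin 3 → ℤ) →* ((Set.univ : Set Space3) ≃ᵢ (Set.univ : Set Space3)))
    (τ C₁ C₂ : Set Space3)
    (hτ : IsTriplyPeriodicTangle σ τ)
    (hC₁ : IsTangleComponent C₁ τ) (hC₂ : IsTangleComponent C₂ τ) :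
    ∃ (ρ : Multiplicative (Fin 2 → ℤ) →* (thickenedPlane ≃ᵢ thickenedPlane))
      (τ₀ : Set Space3) (ι : thickenedPlane → Space3) (D₁ D₂ : Set Space3),
      IsDoublyPeriodicTangle ρ τ₀ ∧
      IsOrientedEmbedding ι ∧
      IsTangleComponent D₁ τ₀ ∧ IsTangleComponent D₂ τ₀ ∧
      -- `ρ` is the restriction of `σ` to a subgroup `ℤ² ≅ j(ℤ²) ⊆ ℤ³`, transported along `ι`
      (∃ j : Multiplicative (Fin 2 → ℤ) →* Multiplicative (Fin 3 → ℤ),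
        Function.Injective j ∧
        ∀ g x, ι (ρ g x) = (σ (j g) ⟨ι x, Set.mem_univ _⟩ : Space3)) ∧
      ι '' ((↑) ⁻¹' τ₀) ⊆ τ ∧
      ι '' ((↑) ⁻¹' D₁) = C₁ ∧
      ι '' ((↑) ⁻¹' D₂) = C₂ := by
  obtain ⟨v, hv, hσ, K, hcc⟩ := hτ.exists_isCocompactCurve
  obtain ⟨x₁, hx₁, rfl⟩ := hC₁
  obtain ⟨x₂, hx₂, rfl⟩ := hC₂
  obtain ⟨_, ⟨m₁, rfl⟩, hb₁⟩ := hcc.exists_component_bounded hx₁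
  obtain ⟨_, ⟨m₂, rfl⟩, hb₂⟩ := hcc.exists_component_bounded hx₂
  obtain ⟨u, hu, hplane⟩ := exists_lattice_plane hv m₁ m₂
  -- The functional comes first and the thickness later, because the bounds `R₁` and `R₂` depend on
  -- `f`.
  obtain ⟨f, hfu, hslab⟩ := exists_slab_coordinates hu
  obtain ⟨R₁, hR₁⟩ := hb₁ f (hplane f hfu).1
  obtain ⟨R₂, hR₂⟩ := hb₂ f (hplane f hfu).2
  obtain ⟨r, M, t, hrpos, hr, hdet, hM, hfM, hft⟩ := hslab (max R₁ R₂)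
  set T : Space3 ≃ₜ Space3 := M.toHomeomorph.trans (Homeomorph.addRight t) with hT
  have hTapp : ∀ x, T x = M x + t := fun _ => rfl
  have hslabT : ∀ x, |f (T x)| < |r| → x 2 ∈ Ioo (0 : ℝ) 1 := by
    intro x hx
    have h : f (T x) = r * (2 * x 2 - 1) := by rw [hTapp, map_add, hfM, hft]; ring
    rw [h, abs_mul, mul_lt_iff_lt_one_right hrpos, abs_lt] at hx
    constructor <;> linarith [hx.1, hx.2]
  have hTadd : ∀ (x : Space3) (m : Fin 2 → ℤ), T (x + latticeHom horizontalBasis m) =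
      T x + latticeHom v (latticeHom u m) := by
    intro x m
    have : M (latticeHom horizontalBasis m) = latticeHom v (latticeHom u m) := by
      rw [map_latticeHom, map_latticeHom]
      simp only [hM]
    rw [hTapp, hTapp, map_add, this]
    abel
  have hfadd : ∀ (q : Space3) (m : Fin 2 → ℤ), f (q + latticeHom v (latticeHom u m)) = f q := by
    intro q m
    rw [map_add, map_latticeHom (latticeHom v), map_latticeHom f]
    simp only [hfu]
    simp [latticeHom_apply]
  -- Only whole components inside the open slab are kept; cutting `τ` along the slab would create
  -- endpoints.
  let Q : Set Space3 → Prop := fun C => ∀ y ∈ C, |f y| < |r|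
  set N : Set Space3 := {q | q ∈ τ ∧ Q (connectedComponentIn τ q)} with hN
  have hNslab : ∀ q ∈ N, |f q| < |r| := fun q hq => hq.2 q (mem_connectedComponentIn hq.1)
  have hNadd : ∀ q ∈ N, ∀ m : Fin 2 → ℤ, q + latticeHom v (latticeHom u m) ∈ N := by
    intro q hq m
    have hmem : latticeHom v (latticeHom u m) ∈ (latticeHom v).range := ⟨_, rfl⟩
    refine ⟨hcc.add_mem _ hmem q hq.1, ?_⟩
    rw [connectedComponentIn_add (hcc.add_mem _ hmem) (hcc.add_mem _ (neg_mem hmem)) hq.1]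
    rintro _ ⟨y, hy, rfl⟩
    rw [hfadd]
    exact hq.2 y hy
  have hQ₁ : Q (connectedComponentIn τ x₁) := fun y hy =>
    (hR₁ y hy).trans_lt ((le_max_left _ _).trans_lt hr)
  have hQ₂ : Q (connectedComponentIn τ x₂) := fun y hy =>
    (hR₂ y hy).trans_lt ((le_max_right _ _).trans_lt hr)
  have hcomp : ∀ x ∈ τ, Q (connectedComponentIn τ x) →
      IsTangleComponent (connectedComponentIn τ x) N := fun x hx hQ =>
    ⟨x, ⟨hx, hQ⟩, (connectedComponentIn_union_components hx hQ).symm⟩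
  have himage : ∀ C, Q C →
      (fun x : thickenedPlane => M x + t) '' ((↑) ⁻¹' (T ⁻¹' C)) = C := by
    intro C hC
    ext y
    constructor
    · rintro ⟨x, hx, rfl⟩
      exact hx
    · intro hy
      have hTy : T (T.symm y) = y := T.apply_symm_apply y
      refine ⟨⟨T.symm y, Ioo_subset_Icc_self (hslabT _ (hTy.symm ▸ hC y hy))⟩, ?_, hTy⟩
      change T (T.symm y) ∈ C
      rwa [hTy]
  refine ⟨horizontalAction, T ⁻¹' N, fun x => M x + t, T ⁻¹' connectedComponentIn τ x₁,
    T ⁻¹' connectedComponentIn τ x₂, ⟨isTranslational_horizontalAction, ?_, ?_, ?_, ?_⟩,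
    isOrientedEmbedding_affine M hdet t, (hcomp x₁ hx₁ hQ₁).preimage T,
    (hcomp x₂ hx₂ hQ₂).preimage T, ⟨(latticeHom u).toMultiplicative, ?_, ?_⟩, ?_,
    himage _ hQ₁, himage _ hQ₂⟩
  · refine (hcc.curve_union_components Q).preimage T (M.contDiff.add contDiff_const) ?_
    exact M.symm.contDiff.comp (contDiff_id.add contDiff_const : ContDiff ℝ ∞ fun x => x + -t)
  · exact fun x hx => openSlab_subset_interior (hslabT x (hNslab _ hx))
  · exact ((hcc.closed_union_components Q).preimage T.continuous).preimage continuous_subtype_val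
  · have hsub : ∀ (g : Multiplicative (Fin 2 → ℤ)) (x : thickenedPlane),
        T x ∈ N → T (horizontalAction g x) ∈ N := by
      intro g x hx
      rw [horizontalAction_apply, hTadd]
      exact hNadd _ hx _
    intro g
    ext x
    constructor
    · rintro ⟨y, hy, rfl⟩
      exact hsub g y hy
    -- Invariance under `g⁻¹` upgrades the inclusion to equality.
    · intro hx
      refine ⟨horizontalAction g⁻¹ x, hsub g⁻¹ x hx, ?_⟩
      rw [← IsometryEquiv.mul_apply, ← map_mul, mul_inv_cancel, map_one, IsometryEquiv.coe_one, id]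
  · intro g h hgh
    have h' : latticeHom u g.toAdd = latticeHom u h.toAdd := hgh
    refine Multiplicative.toAdd.injective (latticeHom_injective hu ?_)
    have := congrArg (latticeHom v) h'
    rwa [map_latticeHom, map_latticeHom] at this
  · intro g x
    rw [hσ]
    exact hTadd x g.toAdd
  · rintro _ ⟨x, hx, rfl⟩
    exact hx.1
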